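/- All rings are associative with identity, not necessarily commutative. For a ring $S$ let $\mathrm{nil}(S)$ be its set of nilpotent elements; $S$ is reduced if $\mathrm{nil}(S)=\{0\}$, and $2$-primal if $\mathrm{nil}(S)$ equals the prime radical of $S$ (the intersection of all prime two-sided ideals). Let $Z_N(S)^*$ be the set of non-zero $a\in S$ such that $ab\in\mathrm{nil}(S)$ for some non-zero $b\in S$. The nilpotent graph $\Gamma_N(S)$ has vertex set $Z_N(S)^*$, distinct vertices $a,b$ being adjacent iff $ab\in\mathrm{nil}(S)$. The zero-divisor graph $\Gamma(S)$ has as vertices the non-zero left or right zero divisors of $S$, distinct vertices $a,b$ being adjacent iff $ab=0$ or $ba=0$. The diameter of a graph is the supremum in $\mathbb{N}\cup\{\infty\}$ of the distances between its vertices (and $0$ if there are no vertices). Let $n\ge 1$ and let $A=\sigma(R)\langle x_1,\dots,x_n\rangle$ be a skew PBW extension of $R$, that is: $R$ is a subring of $A$ with the same identity; $x_1,\dots,x_n\in A$ and the monomials $x_1^{\alpha_1}\cdots x_n^{\alpha_n}$, $\alpha\in\mathbb{N}^n$, form a basis of $A$ as a left $R$-module; for each $i$ and each non-zero $r\in R$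 there is a non-zero $c\in R$ with $x_ir-cx_i\in R$; and for all $i,j$ there is a non-zero $d\in R$ with $x_jx_i-dx_ix_j\in R+Rx_1+\cdots+Rx_n$. Let $\sigma_i,\delta_i:R\to R$ be the maps determined by $x_ir=\sigma_i(r)x_i+\delta_i(r)$ for all $r\in R$, and write $\sigma^\alpha=\sigma_1^{\alpha_1}\circ\cdots\circ\sigma_n^{\alpha_n}$ and $\delta^\beta=\delta_1^{\beta_1}\circ\cdots\circ\delta_n^{\beta_n}$. Suppose that $R$ is $(\Sigma,\Delta)$-compatible, i.e. for all $a,b\in R$ and $\alpha,\beta\in\mathbb{N}^n$ one has $a\sigma^\alpha(b)=0\iff ab=0$, and $ab=0$ implies $a\delta^\beta(b)=0$; and suppose that $R$ is $2$-primal. Then: 1. $\mathrm{diam}(\Gamma_N(A))\le 3$, and if $Z_N(A)^*\neq\emptyset$, i.e. if $\Gamma_N(A)$ has a vertex, then $2\le\mathrm{diam}(\Gamma_N(A))$. 2. If $R$ is not reduced, then $\mathrm{diam}(\Gamma_N(A))=2$. 3. If $R$ is reduced, then $\mathrm{diam}(\Gamma_N(A))=\mathrm{diam}(\Gamma(A))\le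 3$. -/

import Mathlib

namespace NilpotentGraphPaper

/-! ### Two-primal rings -/

/-- A proper two-sided ideal `P` of a (not necessarily commutative) ring is prime if
`I J ⊆ P` implies `I ⊆ P` or `J ⊆ P` for all two-sided ideals `I`, `J`. -/
def IsPrimeIdeal {R : Type*} [Ring R] (P : TwoSidedIdeal R) : Prop :=
  P ≠ ⊤ ∧ ∀ I J : TwoSidedIdeal R, (∀ a ∈ I, ∀ b ∈ J, a * b ∈ P) → I ≤ P ∨ J ≤ P

/-- The prime radical `P(R)`: the intersection of all prime ideals. -/
def primeRadical (R : Type*) [Ring R] : Set R :=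
  {a | ∀ P : TwoSidedIdeal R, IsPrimeIdeal P → a ∈ P}

/-- `R` is 2-primal if `P(R) = nil(R)`. -/
def IsTwoPrimal (R : Type*) [Ring R] : Prop :=
  primeRadical R = {a : R | IsNilpotent a}

/-! ### Nilpotent graph and zero-divisor graph -/

/-- `Z_N(R)^*`: the nonzero `a` such that `a * b` is nilpotent for some nonzero `b`. -/
def nilZeroDivisors (R : Type*) [Ring R] : Set R :=
  {a | a ≠ 0 ∧ ∃ b : R, b ≠ 0 ∧ IsNilpotent (a * b)}

theorem isNilpotent_mul_swap {R : Type*} [Ring R] {a b : R} (h : IsNilpotent (a * b)) :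
    IsNilpotent (b * a) := by
  obtain ⟨k, hk⟩ := h
  have key : ∀ m : ℕ, (b * a) ^ (m + 1) = b * (a * b) ^ m * a := by
    intro m
    induction m with
    | zero => simp
    | succ m ih => rw [pow_succ, ih, pow_succ (a * b)]; simp only [mul_assoc]
  exact ⟨k + 1, by rw [key, hk]; simp⟩

/-- The nilpotent graph `Γ_N(R)`: its vertices are the elements of `Z_N(R)^*`, and distinct
vertices `a`, `b` are adjacent iff `a * b` is nilpotent. -/
def nilpotentGraph (R : Type*) [Ring R] : SimpleGraph (nilZeroDivisors R) where
  Adj a b := a ≠ b ∧ IsNilpotent ((a : R) * (b : R))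
  symm := ⟨fun _ _ h => ⟨h.1.symm, isNilpotent_mul_swap h.2⟩⟩
  loopless := ⟨fun _ h => h.1 rfl⟩

/-- `Z(R)^*`: the nonzero left or right zero divisors of `R`. -/
def zeroDivisors (R : Type*) [Ring R] : Set R :=
  {a | a ≠ 0 ∧ ∃ b : R, b ≠ 0 ∧ (a * b = 0 ∨ b * a = 0)}

/-- The zero-divisor graph `Γ(R)`: its vertices are the elements of `Z(R)^*`, and distinct
vertices `a`, `b` are adjacent iff `a * b = 0` or `b * a = 0`. -/
def zeroDivisorGraph (R : Type*) [Ring R] : SimpleGraph (zeroDivisors R) where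
  Adj a b := a ≠ b ∧ ((a : R) * (b : R) = 0 ∨ (b : R) * (a : R) = 0)
  symm := ⟨fun _ _ h => ⟨h.1.symm, h.2.symm⟩⟩
  loopless := ⟨fun _ h => h.1 rfl⟩

/-! ### Skew PBW extensions -/

/-- The standard monomial `x_1 ^ α_1 * ⋯ * x_n ^ α_n`, in this order. -/
def stdMonomial {A : Type*} [Ring A] {n : ℕ} (x : Fin n → A) (α : Fin n → ℕ) : A :=
  (List.ofFn fun i => x i ^ α i).prod

/-- `A` is a skew PBW extension `σ(R)⟨x_1, …, x_n⟩` of its subring `R`. -/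
structure IsSkewPBWExtension {A : Type*} [Ring A] (R : Subring A) {n : ℕ} (x : Fin n → A) :
    Prop where
  /-- The standard monomials are linearly independent in the left `R`-module `A`. -/
  linearIndependent : LinearIndependent R (stdMonomial x)
  /-- The standard monomials span the left `R`-module `A`. -/
  span_eq_top : Submodule.span R (Set.range (stdMonomial x)) = ⊤
  /-- For `r ≠ 0` in `R` there is `c ≠ 0` in `R` with `x_i r - c x_i ∈ R`. -/
  exists_coeff : ∀ (i : Fin n) (r : R), r ≠ 0 →
    ∃ c : R, c ≠ 0 ∧ x i * (r : A) - (c : A) * x i ∈ R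
  /-- There is `d ≠ 0` in `R` with `x_j x_i - d x_i x_j ∈ R + R x_1 + ⋯ + R x_n`. -/
  exists_comm : ∀ i j : Fin n, ∃ d : R, d ≠ 0 ∧ ∃ (r₀ : R) (r : Fin n → R),
    x j * x i - (d : A) * (x i * x j) = (r₀ : A) + ∑ k, (r k : A) * x k

theorem stdMonomial_zero {A : Type*} [Ring A] {n : ℕ} (x : Fin n → A) :
    stdMonomial x 0 = 1 := by
  simp [stdMonomial]

theorem stdMonomial_single {A : Type*} [Ring A] {n : ℕ} (x : Fin n → A) (i : Fin n) :
    stdMonomial x (Pi.single i 1) = x i := by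
  induction n with
  | zero => exact i.elim0
  | succ n ih =>
    unfold stdMonomial
    rw [List.ofFn_succ, List.prod_cons]
    refine Fin.cases ?_ (fun j => ?_) i
    · simp
    · have h := ih (fun k => x k.succ) j
      unfold stdMonomial at h
      have h2 : ∀ k : Fin n, (Pi.single j.succ 1 : Fin (n + 1) → ℕ) k.succ
          = (Pi.single j 1 : Fin n → ℕ) k := by
        intro k
        simp [Pi.single_apply]
      simp [h2, h]

namespace IsSkewPBWExtension

variable {A : Type*} [Ring A] {R : Subring A} {n : ℕ} {x : Fin n → A}

/-- The left `R`-basis of `A` formed by the standard monomials. -/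
noncomputable def basis (h : IsSkewPBWExtension R x) : Module.Basis (Fin n → ℕ) R A :=
  Module.Basis.mk h.linearIndependent h.span_eq_top.ge

/-- `σ_i(r)`: the coefficient of `x_i` in `x_i r`. -/
noncomputable def sigma (h : IsSkewPBWExtension R x) (i : Fin n) (r : R) : R :=
  h.basis.repr (x i * (r : A)) (Pi.single i 1)

/-- `δ_i(r)`: the constant coefficient of `x_i r`. -/
noncomputable def delta (h : IsSkewPBWExtension R x) (i : Fin n) (r : R) : R :=
  h.basis.repr (x i * (r : A)) 0

/-- `σ_i` and `δ_i` are determined by the relation `x_i r = σ_i(r) x_i + δ_i(r)`. -/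
theorem eq_sigma_delta (h : IsSkewPBWExtension R x) {i : Fin n} {r s t : R}
    (hst : x i * (r : A) = (s : A) * x i + (t : A)) : h.sigma i r = s ∧ h.delta i r = t := by
  have h1 : x i * (r : A) = s • h.basis (Pi.single i 1) + t • h.basis 0 := by
    simp only [basis, Module.Basis.mk_apply, stdMonomial_zero, stdMonomial_single,
      Subring.smul_def, smul_eq_mul, mul_one]
    exact hst
  have hne : (Pi.single i 1 : Fin n → ℕ) ≠ 0 := by simp
  unfold sigma delta
  rw [h1]
  constructor <;> simp [hne, hne.symm]

/-- The relation `x_i r = σ_i(r) x_i + δ_i(r)`. -/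
theorem mul_eq_sigma_delta (h : IsSkewPBWExtension R x) (i : Fin n) (r : R) :
    x i * (r : A) = (h.sigma i r : A) * x i + (h.delta i r : A) := by
  have key : ∃ s t : R, x i * (r : A) = (s : A) * x i + (t : A) := by
    by_cases hr : r = 0
    · exact ⟨0, 0, by simp [hr]⟩
    · obtain ⟨c, -, hc⟩ := h.exists_coeff i r hr
      exact ⟨c, ⟨_, hc⟩, by simp⟩
  obtain ⟨s, t, hst⟩ := key
  obtain ⟨h1, h2⟩ := h.eq_sigma_delta hst
  rw [h1, h2, hst]

end IsSkewPBWExtension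

/-! ### Compatibility -/

/-- The composition `f_1 ^ α_1 ∘ ⋯ ∘ f_n ^ α_n` of iterates of self-maps. -/
def iterComp {R : Type*} {n : ℕ} (f : Fin n → R → R) (α : Fin n → ℕ) : R → R :=
  (List.ofFn fun i => (f i)^[α i]).foldr (fun g k => g ∘ k) id

/-- `(Σ, Δ)`-compatibility of a ring with respect to families `σ`, `δ` of self-maps. -/
def IsCompatible {R : Type*} [Ring R] {n : ℕ} (σ δ : Fin n → R → R) : Prop :=
  (∀ (a b : R) (α : Fin n → ℕ), a * iterComp σ α b = 0 ↔ a * b = 0) ∧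
  (∀ (a b : R) (β : Fin n → ℕ), a * b = 0 → a * iterComp δ β b = 0)

end NilpotentGraphPaper

/-! The argument splits on whether `R` is reduced.

If it is not, some non-zero `r` satisfies `r R r = 0`: otherwise `R` would be semiprime, so its
prime radical, which is nil(`R`) by 2-primality, would vanish. By compatibility an annihilation `a *
b = 0` in `R` survives inserting any word in the variables, so `r A r = 0` and every `r * f` is
nilpotent. Thus all non-zero elements are vertices and `r` is joined to all others, giving diameter
at most 2; the vertices 1 and `x i` are not adjacent, since `x i` is not nilpotent.

If `R` is reduced, so is `A` (`IsSkewPBWExtension.isReduced`). The commutation coefficients are then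
units, so sorting a word costs a unit and shorter words, and the square of a non-zero element has a
non-zero leading coefficient. In a reduced ring nilpotent means zero and `a * b = 0` is symmetric,
so the two graphs coincide and the classical bound 3 applies. The lower bound fails for rings such
as F₂ × F₂; it needs a non-idempotent element, supplied by `x i`. -/

namespace NilpotentGraphPaper

/-! ### Prime radical -/

/-- In a semiprime ring every non-zero element avoids some prime ideal. -/
theorem eq_zero_of_mem_primeRadical {S : Type*} [Ring S]
    (hS : ∀ r : S, (∀ s, r * s * r = 0) → r = 0) {a : S} (ha : a ∈ primeRadical S) : a = 0 := by
  by_contra ha0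
  have step : ∀ r : {r : S // r ≠ 0}, ∃ s : S, r.1 * s * r.1 ≠ 0 := by
    intro r
    by_contra! h
    exact r.2 (hS _ h)
  choose t ht using step
  -- A sequence `u (k + 1) = u k * t * u k` of non-zero elements starting at `a`. An ideal maximal
  -- among those avoiding it is prime and misses `a`.
  let u : ℕ → {r : S // r ≠ 0} := fun k =>
    Nat.rec ⟨a, ha0⟩ (fun _ r => ⟨r.1 * t r * r.1, ht r⟩) k
  have hu : ∀ k, (u (k + 1)).1 = (u k).1 * t (u k) * (u k).1 := fun _ => rfl
  have hmono : ∀ (I : TwoSidedIdeal S) (k l : ℕ), k ≤ l → (u k).1 ∈ I → (u l).1 ∈ I := by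
    intro I k l hkl hk
    induction l, hkl using Nat.le_induction with
    | base => exact hk
    | succ l _ ih => rw [hu]; exact I.mul_mem_left _ _ ih
  obtain ⟨P, -, hP, hmax⟩ := zorn_le_nonempty₀ {I : TwoSidedIdeal S | ∀ k, (u k).1 ∉ I}
    (by
      intro c hc hchain y hy
      have hdir : ∀ I ∈ c, ∀ J ∈ c, ∃ K ∈ c, I ≤ K ∧ J ≤ K := by
        intro I hI J hJ
        rcases hchain.total hI hJ with h | h
        · exact ⟨J, hJ, h, le_rfl⟩
        · exact ⟨I, hI, le_rfl, h⟩
      refine ⟨TwoSidedIdeal.mk' {z | ∃ I ∈ c, z ∈ I} ⟨y, hy, y.zero_mem⟩ ?_ ?_ ?_ ?_, ?_, ?_⟩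
      · rintro z w ⟨I, hI, hz⟩ ⟨J, hJ, hw⟩
        obtain ⟨K, hK, hIK, hJK⟩ := hdir I hI J hJ
        exact ⟨K, hK, K.add_mem (hIK hz) (hJK hw)⟩
      · rintro z ⟨I, hI, hz⟩
        exact ⟨I, hI, I.neg_mem hz⟩
      · rintro z w ⟨I, hI, hz⟩
        exact ⟨I, hI, I.mul_mem_left _ _ hz⟩
      · rintro z w ⟨I, hI, hz⟩
        exact ⟨I, hI, I.mul_mem_right _ _ hz⟩
      · intro k hk
        rw [TwoSidedIdeal.mem_mk'] at hk
        obtain ⟨I, hI, hk⟩ := hk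
        exact hc hI k hk
      · intro I hI z hz
        have : z ∈ {z | ∃ I ∈ c, z ∈ I} := ⟨I, hI, hz⟩
        exact (TwoSidedIdeal.mem_mk' _ _ _ _ _ _ z).2 this)
    ⊥ (fun k hk => (u k).2 ((TwoSidedIdeal.mem_bot S).1 hk))
  refine hP 0 (ha P ⟨?_, ?_⟩)
  · rintro rfl
    exact hP 0 trivial
  · intro I J hIJ
    by_contra! h
    have hmeet : ∀ I : TwoSidedIdeal S, ¬ I ≤ P → ∃ k, (u k).1 ∈ I ⊔ P := by
      intro I hI
      by_contra! hk
      exact hI (le_sup_left.trans (hmax hk le_sup_right))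
    obtain ⟨k, hk⟩ := hmeet I h.1
    obtain ⟨l, hl⟩ := hmeet J h.2
    have hk' := hmono _ k (max k l) (le_max_left _ _) hk
    have hl' := hmono _ l (max k l) (le_max_right _ _) hl
    obtain ⟨i, hi, p, hp, hip⟩ := TwoSidedIdeal.mem_sup.1 hk'
    obtain ⟨j, hj, q, hq, hjq⟩ := TwoSidedIdeal.mem_sup.1 hl'
    apply hP (max k l + 1)
    -- Here `i + p = u m = j + q` with `m = max k l`; expanding `u m * t * u m` leaves one term in
    -- `I J` and the rest in `P`.
    have : (u (max k l + 1)).1 = (i * t (u (max k l))) * j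
        + ((i * t (u (max k l))) * q + p * (t (u (max k l)) * (j + q))) := by
      rw [hu]
      nth_rw 1 [← hip]
      nth_rw 1 [← hjq]
      noncomm_ring
    rw [this]
    exact P.add_mem (hIJ _ (I.mul_mem_right _ _ hi) _ hj)
      (P.add_mem (P.mul_mem_left _ _ hq) (P.mul_mem_right _ _ hp))

/-- A 2-primal ring that is not reduced is not semiprime. -/
theorem IsTwoPrimal.exists_mul_mul_eq_zero {S : Type*} [Ring S] (h : IsTwoPrimal S)
    (hS : ¬ IsReduced S) : ∃ r : S, r ≠ 0 ∧ ∀ s, r * s * r = 0 := by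
  by_contra! hsemi
  refine hS ⟨fun a ha => eq_zero_of_mem_primeRadical (fun r hr => ?_) (h.symm ▸ ha)⟩
  by_contra hr0
  obtain ⟨s, hs⟩ := hsemi r hr0
  exact hs (hr s)

/-! ### Reduced rings -/

section Reduced

variable {S : Type*} [Ring S]

theorem isReduced_of_mul_self (h : ∀ a : S, a * a = 0 → a = 0) : IsReduced S :=
  isReduced_iff_pow_one_lt 2 (by norm_num) |>.2 fun a ha => h a (by rwa [← sq])

variable [IsReduced S]

theorem mul_eq_zero_swap {a b : S} (h : a * b = 0) : b * a = 0 := by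
  refine IsReduced.eq_zero _ ⟨2, ?_⟩
  rw [sq, mul_assoc, ← mul_assoc a, h, zero_mul, mul_zero]

theorem mul_mul_eq_zero {a b : S} (h : a * b = 0) (c : S) : a * c * b = 0 := by
  refine IsReduced.eq_zero _ ⟨2, ?_⟩
  rw [sq, mul_assoc (a * c) b, mul_assoc a c b, ← mul_assoc b, mul_eq_zero_swap h, zero_mul,
    mul_zero]

/-- Reduced rings are Dedekind-finite; this turns the commutation coefficients into units. -/
theorem isUnit_of_mul_eq_one_of_isReduced {e d : S} (h : e * d = 1) : IsUnit e ∧ IsUnit d := by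
  have hud : (1 - d * e) * d = 0 := by rw [sub_mul, one_mul, mul_assoc, h, mul_one, sub_self]
  have hdu : d * (1 - d * e) = 0 := mul_eq_zero_swap hud
  have hu : 1 - d * e = 0 := by
    calc 1 - d * e = e * d * (1 - d * e) := by rw [h, one_mul]
      _ = 0 := by rw [mul_assoc, hdu, mul_zero]
  have h' : d * e = 1 := (sub_eq_zero.1 hu).symm
  exact ⟨⟨⟨e, d, h, h'⟩, rfl⟩, ⟨⟨d, e, h', h⟩, rfl⟩⟩

theorem mul_comm_of_isIdempotentElem {e : S} (he : e * e = e) (a : S) : e * a = a * e := by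
  have h1 : e * (1 - e) = 0 := by rw [mul_sub, he, mul_one, sub_self]
  have h2 := mul_mul_eq_zero h1 a
  have h3 := mul_mul_eq_zero (mul_eq_zero_swap h1) a
  rw [mul_sub, mul_one, sub_eq_zero] at h2
  rw [sub_mul, sub_mul, one_mul, sub_eq_zero] at h3
  exact h2.trans h3.symm

end Reduced

/-! ### Diameters -/

theorem two_le_ediam {V : Type*} {G : SimpleGraph V} {u v : V} (h : u ≠ v) (hadj : ¬ G.Adj u v) :
    2 ≤ G.ediam := by
  refine le_trans ?_ (SimpleGraph.edist_le_ediam (u := u) (v := v))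
  by_contra! hlt
  have h1 : G.edist u v ≤ 1 := ENat.lt_add_one_iff (by simp) |>.1 (by rwa [one_add_one_eq_two])
  rcases SimpleGraph.edist_le_one_iff_adj_or_eq.1 h1 with h2 | h2
  · exact hadj h2
  · exact h h2

/-- Adjacency is required only for distinct vertices, so the paths built from these bounds may have
coinciding vertices. -/
theorem edist_le_one {V : Type*} {G : SimpleGraph V} {u v : V} (h : u ≠ v → G.Adj u v) :
    G.edist u v ≤ 1 := by
  rw [SimpleGraph.edist_le_one_iff_adj_or_eq]
  tauto

theorem edist_le_two {V : Type*} {G : SimpleGraph V} {u v : V} (w : V) (h : u ≠ w → G.Adj u w)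
    (h' : w ≠ v → G.Adj w v) : G.edist u v ≤ 2 :=
  (SimpleGraph.edist_triangle (v := w)).trans
    ((add_le_add (edist_le_one h) (edist_le_one h')).trans (by norm_num))

theorem edist_le_three {V : Type*} {G : SimpleGraph V} {u v : V} (w z : V)
    (h : u ≠ w → G.Adj u w) (h' : w ≠ z → G.Adj w z) (h'' : z ≠ v → G.Adj z v) :
    G.edist u v ≤ 3 :=
  (SimpleGraph.edist_triangle (v := w)).trans
    ((add_le_add (edist_le_one h) (edist_le_two z h' h'')).trans (by norm_num))

theorem ediam_congr {S : Type*} {s t : Set S} {G : SimpleGraph s} {H : SimpleGraph t}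
    (hst : s = t) (h : ∀ (a b : S) (ha : a ∈ s) (hb : b ∈ s) (ha' : a ∈ t) (hb' : b ∈ t),
      G.Adj ⟨a, ha⟩ ⟨b, hb⟩ ↔ H.Adj ⟨a, ha'⟩ ⟨b, hb'⟩) : G.ediam = H.ediam := by
  subst hst
  congr 1
  ext a b
  exact h a b a.2 b.2 a.2 b.2

/-! ### The nilpotent graph of a reduced ring -/

section ReducedGraph

variable {S : Type*} [Ring S] [IsReduced S]

theorem mem_nilZeroDivisors_iff {a : S} :
    a ∈ nilZeroDivisors S ↔ a ≠ 0 ∧ ∃ b : S, b ≠ 0 ∧ a * b = 0 := by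
  simp only [nilZeroDivisors, Set.mem_ofPred_eq, isNilpotent_iff_eq_zero]

theorem nilZeroDivisors_eq_zeroDivisors : nilZeroDivisors S = zeroDivisors S := by
  ext a
  rw [mem_nilZeroDivisors_iff]
  refine and_congr_right fun _ => exists_congr fun b => and_congr_right fun _ => ?_
  exact ⟨Or.inl, fun h => h.elim id mul_eq_zero_swap⟩

theorem ediam_nilpotentGraph_eq_ediam_zeroDivisorGraph :
    (nilpotentGraph S).ediam = (zeroDivisorGraph S).ediam := by
  refine ediam_congr nilZeroDivisors_eq_zeroDivisors fun a b _ _ _ _ => ?_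
  simp only [nilpotentGraph, zeroDivisorGraph, isNilpotent_iff_eq_zero, ne_eq, Subtype.mk.injEq]
  exact and_congr_right fun _ => ⟨Or.inl, fun h => h.elim id mul_eq_zero_swap⟩

/-- With `a * c = 0` and `b * d = 0`, the path is `a, c, d, b` if `c * d = 0`, and `a, c * d, b`
otherwise. -/
theorem ediam_nilpotentGraph_le_three : (nilpotentGraph S).ediam ≤ 3 := by
  refine SimpleGraph.ediam_le_of_edist_le ?_
  rintro ⟨a, ha⟩ ⟨b, hb⟩
  obtain ⟨ha0, c, hc0, hac⟩ := mem_nilZeroDivisors_iff.1 ha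
  obtain ⟨hb0, d, hd0, hbd⟩ := mem_nilZeroDivisors_iff.1 hb
  have adj : ∀ {p q : S} (hp : p ∈ nilZeroDivisors S) (hq : q ∈ nilZeroDivisors S), p * q = 0 →
      (⟨p, hp⟩ : nilZeroDivisors S) ≠ ⟨q, hq⟩ → (nilpotentGraph S).Adj ⟨p, hp⟩ ⟨q, hq⟩ :=
    fun _ _ h hne => ⟨hne, isNilpotent_iff_eq_zero.2 h⟩
  have hcmem : c ∈ nilZeroDivisors S :=
    mem_nilZeroDivisors_iff.2 ⟨hc0, a, ha0, mul_eq_zero_swap hac⟩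
  have hdmem : d ∈ nilZeroDivisors S :=
    mem_nilZeroDivisors_iff.2 ⟨hd0, b, hb0, mul_eq_zero_swap hbd⟩
  by_cases hcd : c * d = 0
  · exact edist_le_three ⟨c, hcmem⟩ ⟨d, hdmem⟩ (adj _ _ hac) (adj _ _ hcd)
      (adj _ _ (mul_eq_zero_swap hbd))
  · have hacd : a * (c * d) = 0 := by rw [← mul_assoc, hac, zero_mul]
    have hcdb : c * d * b = 0 := by rw [mul_assoc, mul_eq_zero_swap hbd, mul_zero]
    have hmem : c * d ∈ nilZeroDivisors S :=
      mem_nilZeroDivisors_iff.2 ⟨hcd, b, hb0, hcdb⟩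
    exact (edist_le_two ⟨c * d, hmem⟩ (adj _ _ hacd) (adj _ _ hcdb)).trans (by norm_num)

/-- A reduced ring with a zero divisor in which not every element is idempotent has two distinct
zero divisors whose product is non-zero. -/
theorem two_le_ediam_nilpotentGraph_of_isReduced {y : S} (hy : y * y ≠ y)
    (hne : (nilZeroDivisors S).Nonempty) : 2 ≤ (nilpotentGraph S).ediam := by
  -- If all zero divisors are idempotent, take such an `e`: then `e * y` and `(1 - e) * y` are
  -- idempotent, and since `e` is central so is their sum `y`. Otherwise some `a` differs from `a *
  -- a`, and adjacency of these two would force `a ^ 3 = 0`.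
  by_cases hid : ∀ a ∈ nilZeroDivisors S, a * a = a
  · exfalso
    obtain ⟨e, he⟩ := hne
    have hee := hid e he
    obtain ⟨he0, b, hb0, heb⟩ := mem_nilZeroDivisors_iff.1 he
    have h1 : e * (1 - e) = 0 := by rw [mul_sub, hee, mul_one, sub_self]
    have h1e : 1 - e ≠ 0 := by
      intro h
      rw [← sub_eq_zero.1 h, one_mul] at heb
      exact hb0 heb
    have key : ∀ p q : S, p ≠ 0 → q * p = 0 → (q * y) * (q * y) = q * y := by
      intro p q hp hqp
      by_cases h0 : q * y = 0
      · rw [h0, mul_zero]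
      · exact hid _ (mem_nilZeroDivisors_iff.2 ⟨h0, p, hp, mul_mul_eq_zero hqp y⟩)
    have k1 := key (1 - e) e h1e h1
    have k2 := key e (1 - e) he0 (mul_eq_zero_swap h1)
    have hcomm := mul_comm_of_isIdempotentElem hee y
    have e1 : e * y * (e * y) = e * (y * y) := by
      rw [mul_assoc, ← mul_assoc y, ← hcomm, ← mul_assoc, ← mul_assoc, hee, mul_assoc]
    have e2 : (1 - e) * y * ((1 - e) * y) = y * y - e * (y * y) := by
      have : (1 - e) * y * ((1 - e) * y) = y * y - e * (y * y) - y * e * y + e * (y * e) * y := by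
        noncomm_ring
      rw [this, ← hcomm, ← mul_assoc e e, hee, mul_assoc, sub_add_cancel]
    apply hy
    rw [e1] at k1
    rw [e2, k1, sub_mul, one_mul] at k2
    exact sub_left_injective k2
  · push Not at hid
    obtain ⟨a, ha, haa⟩ := hid
    obtain ⟨ha0, b, hb0, hab⟩ := mem_nilZeroDivisors_iff.1 ha
    have hmem : a * a ∈ nilZeroDivisors S := mem_nilZeroDivisors_iff.2
      ⟨fun h => ha0 (IsReduced.eq_zero a ⟨2, by rw [sq, h]⟩), b, hb0, mul_mul_eq_zero hab a⟩
    refine two_le_ediam (u := ⟨a, ha⟩) (v := ⟨a * a, hmem⟩) (fun h => haa ?_) fun h => ha0 ?_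
    · exact (congrArg Subtype.val h).symm
    · refine IsReduced.eq_zero a ⟨3, ?_⟩
      rw [pow_succ', sq]
      exact isNilpotent_iff_eq_zero.1 h.2

end ReducedGraph

/-- If multiples of a non-zero `r` are nilpotent, then `r` is adjacent to every other non-zero
element. -/
theorem ediam_nilpotentGraph_le_two {S : Type*} [Ring S] {r : S} (hr0 : r ≠ 0)
    (hr : ∀ a, IsNilpotent (r * a)) : (nilpotentGraph S).ediam ≤ 2 := by
  have hmem : r ∈ nilZeroDivisors S := ⟨hr0, r, hr0, hr r⟩
  refine SimpleGraph.ediam_le_of_edist_le fun a b => ?_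
  exact edist_le_two ⟨r, hmem⟩ (fun h => ⟨h, isNilpotent_mul_swap (hr a)⟩) (fun h => ⟨h, hr b⟩)

/-! ### Standard monomials and words -/

theorem iterComp_single {S : Type*} {n : ℕ} (f : Fin n → S → S) (i : Fin n) :
    iterComp f (Pi.single i 1) = f i := by
  induction n with
  | zero => exact i.elim0
  | succ n ih =>
    unfold iterComp
    rw [List.ofFn_succ, List.foldr_cons]
    refine Fin.cases ?_ (fun j => ?_) i
    · have h0 : ∀ m : ℕ, (List.replicate m (id : S → S)).foldr (fun g k => g ∘ k) id = id := by
        intro m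
        induction m with
        | zero => rfl
        | succ m ih => rw [List.replicate_succ, List.foldr_cons, ih]; rfl
      simp [List.ofFn_const, h0]
    · have h := ih (fun k => f k.succ) j
      unfold iterComp at h
      have h2 : ∀ k : Fin n, (Pi.single j.succ 1 : Fin (n + 1) → ℕ) k.succ
          = (Pi.single j 1 : Fin n → ℕ) k := by
        intro k
        simp [Pi.single_apply]
      simp [h2, h]

section Monomials

variable {A : Type*} [Ring A]

theorem stdMonomial_succ {n : ℕ} (x : Fin (n + 1) → A) (α : Fin (n + 1) → ℕ) :
    stdMonomial x α = x 0 ^ α 0 * stdMonomial (fun k => x k.succ) (fun k => α k.succ) := by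
  unfold stdMonomial
  rw [List.ofFn_succ, List.prod_cons]

theorem stdMonomial_single_eq_pow {n : ℕ} (x : Fin n → A) (i : Fin n) (m : ℕ) :
    stdMonomial x (Pi.single i m) = x i ^ m := by
  induction n with
  | zero => exact i.elim0
  | succ n ih =>
    rw [stdMonomial_succ]
    refine Fin.cases ?_ (fun j => ?_) i
    · have : (fun k : Fin n => (Pi.single 0 m : Fin (n + 1) → ℕ) k.succ) = 0 := by
        ext k; simp
      rw [this, stdMonomial_zero]; simp
    · have : (fun k : Fin n => (Pi.single j.succ m : Fin (n + 1) → ℕ) k.succ) = Pi.single j m := by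
        ext k; simp [Pi.single_apply]
      rw [this, ih]; simp

theorem stdMonomial_single_add_single {n : ℕ} (x : Fin n → A) {i j : Fin n} (hij : i < j) :
    stdMonomial x (Pi.single i 1 + Pi.single j 1) = x i * x j := by
  induction n with
  | zero => exact i.elim0
  | succ n ih =>
    rw [stdMonomial_succ]
    obtain ⟨j, rfl⟩ := Fin.exists_succ_eq.2 (Fin.ne_zero_of_lt hij)
    induction i using Fin.cases with
    | zero =>
      have : (fun k : Fin n => (Pi.single 0 1 + Pi.single j.succ 1 : Fin (n + 1) → ℕ) k.succ)
          = Pi.single j 1 := by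
        ext k; simp [Pi.single_apply]
      rw [this, stdMonomial_single]; simp
    | succ i =>
      have : (fun k : Fin n => (Pi.single i.succ 1 + Pi.single j.succ 1 : Fin (n + 1) → ℕ) k.succ)
          = Pi.single i 1 + Pi.single j 1 := by
        ext k; simp [Pi.single_apply]
      rw [this, ih _ (Fin.succ_lt_succ_iff.1 hij)]; simp

/-- The value in `A` of a word in the variables. -/
def wordVal {n : ℕ} (x : Fin n → A) (w : List (Fin n)) : A := (w.map x).prod

variable {n : ℕ} (x : Fin n → A)

@[simp] theorem wordVal_nil : wordVal x [] = 1 := rfl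

@[simp] theorem wordVal_cons (i : Fin n) (w : List (Fin n)) :
    wordVal x (i :: w) = x i * wordVal x w := by
  simp [wordVal]

theorem wordVal_append (v w : List (Fin n)) :
    wordVal x (v ++ w) = wordVal x v * wordVal x w := by
  simp [wordVal]

/-- The non-decreasing word with exponent vector `α`. -/
def stdWord {n : ℕ} (α : Fin n → ℕ) : List (Fin n) :=
  (List.ofFn fun i => List.replicate (α i) i).flatten

theorem wordVal_stdWord (α : Fin n → ℕ) : wordVal x (stdWord α) = stdMonomial x α := by
  unfold wordVal stdWord stdMonomial
  rw [List.map_flatten, List.prod_flatten, List.map_ofFn, List.map_ofFn]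
  congr 2
  ext i
  simp

theorem length_stdWord (α : Fin n → ℕ) : (stdWord α).length = ∑ i, α i := by
  unfold stdWord
  rw [List.length_flatten, List.map_ofFn, List.sum_ofFn]
  simp

theorem count_stdWord (α : Fin n → ℕ) (i : Fin n) : (stdWord α).count i = α i := by
  unfold stdWord
  rw [List.count_flatten, List.map_ofFn, List.sum_ofFn]
  simp [List.count_replicate]

theorem stdWord_append_perm (α β : Fin n → ℕ) :
    (stdWord α ++ stdWord β).Perm (stdWord (α + β)) := by
  rw [List.perm_iff_count]
  intro i
  simp [count_stdWord]

theorem perm_stdWord_count (w : List (Fin n)) : w.Perm (stdWord fun i => w.count i) := by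
  rw [List.perm_iff_count]
  intro i
  simp [count_stdWord]

end Monomials

/-! ### The filtration by word length -/

section Filtration

variable {A : Type*} [Ring A] (R : Subring A) {n : ℕ} (x : Fin n → A)

/-- The left `R`-span of the words of length less than `k`. -/
def wordSpan (k : ℕ) : Submodule R A :=
  Submodule.span R {a | ∃ w : List (Fin n), w.length < k ∧ wordVal x w = a}

variable {R x}

theorem wordVal_mem_wordSpan {w : List (Fin n)} {k : ℕ} (h : w.length < k) :
    wordVal x w ∈ wordSpan R x k :=
  Submodule.subset_span ⟨w, h, rfl⟩

theorem wordSpan_mono {k l : ℕ} (h : k ≤ l) : wordSpan R x k ≤ wordSpan R x l :=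
  Submodule.span_mono fun _ ⟨w, hw, e⟩ => ⟨w, hw.trans_le h, e⟩

theorem coe_mul_mem_wordSpan (r : R) {a : A} {k : ℕ} (h : a ∈ wordSpan R x k) :
    (r : A) * a ∈ wordSpan R x k :=
  (wordSpan R x k).smul_mem r h

theorem mul_wordVal_mem_wordSpan {a : A} {k : ℕ} (h : a ∈ wordSpan R x k) (w : List (Fin n)) :
    a * wordVal x w ∈ wordSpan R x (k + w.length) := by
  induction h using Submodule.span_induction with
  | mem a ha =>
    obtain ⟨v, hv, rfl⟩ := ha
    rw [← wordVal_append]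
    exact wordVal_mem_wordSpan (by simpa using hv)
  | zero => simp
  | add a b _ _ iha ihb => rw [add_mul]; exact add_mem iha ihb
  | smul r a _ ih =>
    rw [smul_mul_assoc]
    exact Submodule.smul_mem _ _ ih

end Filtration

namespace IsSkewPBWExtension

variable {A : Type*} [Ring A] {R : Subring A} {n : ℕ} {x : Fin n → A}

theorem basis_apply (h : IsSkewPBWExtension R x) (α : Fin n → ℕ) :
    h.basis α = stdMonomial x α := by
  simp [basis]

theorem repr_coe_mul_stdMonomial (h : IsSkewPBWExtension R x) (r : R) (α : Fin n → ℕ) :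
    h.basis.repr ((r : A) * stdMonomial x α) = Finsupp.single α r := by
  have : (r : A) * stdMonomial x α = r • h.basis α := by
    rw [basis_apply, Subring.smul_def, smul_eq_mul]
  rw [this]
  simp

theorem sigma_one (h : IsSkewPBWExtension R x) (i : Fin n) : h.sigma i 1 = 1 :=
  (h.eq_sigma_delta (s := 1) (t := 0) (by simp)).1

theorem sigma_mul (h : IsSkewPBWExtension R x) (i : Fin n) (r s : R) :
    h.sigma i (r * s) = h.sigma i r * h.sigma i s := by
  refine (h.eq_sigma_delta (t := h.sigma i r * h.delta i s + h.delta i r * s) ?_).1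
  push_cast
  rw [← mul_assoc, h.mul_eq_sigma_delta i r, add_mul, mul_assoc, h.mul_eq_sigma_delta i s]
  noncomm_ring

/-- Needed because prefixing `x i` to two words related by a unit `d` replaces `d` by `σ_i(d)`. -/
theorem isUnit_sigma (h : IsSkewPBWExtension R x) (i : Fin n) {d : R} (hd : IsUnit d) :
    IsUnit (h.sigma i d) :=
  hd.map
    ({ toFun := h.sigma i, map_one' := h.sigma_one i, map_mul' := h.sigma_mul i } : R →* R)

theorem mul_mem_wordSpan (h : IsSkewPBWExtension R x) (i : Fin n) {a : A} {k : ℕ}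
    (ha : a ∈ wordSpan R x k) : x i * a ∈ wordSpan R x (k + 1) := by
  induction ha using Submodule.span_induction with
  | mem a ha =>
    obtain ⟨v, hv, rfl⟩ := ha
    rw [← wordVal_cons]
    exact wordVal_mem_wordSpan (by simpa using hv)
  | zero => simp
  | add a b _ _ iha ihb => rw [mul_add]; exact add_mem iha ihb
  | smul r a ha ih =>
    have e : x i * (r • a) = (h.sigma i r : A) * (x i * a) + (h.delta i r : A) * a := by
      rw [Subring.smul_def, smul_eq_mul, ← mul_assoc, h.mul_eq_sigma_delta, add_mul, mul_assoc]
    rw [e]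
    exact add_mem (coe_mul_mem_wordSpan _ ih)
      (coe_mul_mem_wordSpan _ (wordSpan_mono k.le_succ ha))

/-- Moving a coefficient past a word, up to shorter words. -/
theorem exists_wordVal_mul (h : IsSkewPBWExtension R x)
    (hcompat : IsCompatible h.sigma h.delta) (w : List (Fin n)) (r : R) :
    ∃ s : R, wordVal x w * (r : A) - (s : A) * wordVal x w ∈ wordSpan R x w.length ∧
      ∀ a : R, a * s = 0 → a * r = 0 := by
  induction w with
  | nil => exact ⟨r, by simp, fun _ => id⟩
  | cons i w ih =>
    obtain ⟨s, hs, has⟩ := ih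
    refine ⟨h.sigma i s, ?_, fun a ha => has a ?_⟩
    · have e : wordVal x (i :: w) * (r : A) - (h.sigma i s : A) * wordVal x (i :: w)
          = x i * (wordVal x w * (r : A) - (s : A) * wordVal x w)
            + (h.delta i s : A) * wordVal x w := by
        rw [mul_sub, ← mul_assoc (x i) (s : A), h.mul_eq_sigma_delta, wordVal_cons]
        noncomm_ring
      rw [e]
      exact add_mem (h.mul_mem_wordSpan i hs)
        (coe_mul_mem_wordSpan _ (wordVal_mem_wordSpan (by simp)))
    · have := (hcompat.1 a s (Pi.single i 1))
      rw [iterComp_single] at this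
      exact this.1 ha

/-- Words of length below 2 are already standard, so no sorting is involved; the general degree
bound needs the unit coefficients that this case helps to produce. -/
theorem repr_wordSpan_two (h : IsSkewPBWExtension R x) {a : A} (ha : a ∈ wordSpan R x 2)
    {i j : Fin n} : h.basis.repr a (Pi.single i 1 + Pi.single j 1) = 0 := by
  induction ha using Submodule.span_induction with
  | mem a ha =>
    obtain ⟨w, hw, rfl⟩ := ha
    have hrepr : ∀ α : Fin n → ℕ, h.basis.repr (stdMonomial x α) = Finsupp.single α 1 := by
      intro α
      simpa using h.repr_coe_mul_stdMonomial 1 α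
    have hsum : ∀ α : Fin n → ℕ, ∑ k, α k < 2 → α ≠ Pi.single i 1 + Pi.single j 1 := by
      rintro α hα rfl
      simp [Finset.sum_add_distrib] at hα
    match w, hw with
    | [], _ =>
      rw [wordVal_nil, ← stdMonomial_zero x, hrepr]
      exact Finsupp.single_eq_of_ne (hsum 0 (by simp)).symm
    | [k], _ =>
      rw [wordVal_cons, wordVal_nil, mul_one, ← stdMonomial_single x k, hrepr]
      exact Finsupp.single_eq_of_ne (hsum _ (by simp)).symm
  | zero => simp
  | add a b _ _ iha ihb => simp [iha, ihb]
  | smul r a _ ih => simp [ih]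

theorem exists_isUnit_comm (h : IsSkewPBWExtension R x) [IsReduced R] (i j : Fin n) :
    ∃ d : R, IsUnit d ∧ x j * x i - (d : A) * (x i * x j) ∈ wordSpan R x 2 := by
  have hex : ∀ i j : Fin n, ∃ d : R, x j * x i - (d : A) * (x i * x j) ∈ wordSpan R x 2 := by
    intro i j
    obtain ⟨d, -, r₀, r, hd⟩ := h.exists_comm i j
    refine ⟨d, hd ▸ add_mem ?_ (sum_mem fun k _ => coe_mul_mem_wordSpan _ ?_)⟩
    · simpa using coe_mul_mem_wordSpan r₀ (wordVal_mem_wordSpan (R := R) (x := x) (w := [])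
        (k := 2) (by simp))
    · simpa using wordVal_mem_wordSpan (R := R) (x := x) (w := [k]) (k := 2) (by simp)
  -- Substituting one commutation relation into the other puts `(1 - e * d) x_i x_j` in the span of
  -- shorter words; as `i < j`, `x_i x_j` is a basis element.
  have hlt : ∀ i j : Fin n, i < j → ∀ d e : R,
      x j * x i - (d : A) * (x i * x j) ∈ wordSpan R x 2 →
      x i * x j - (e : A) * (x j * x i) ∈ wordSpan R x 2 → e * d = 1 := by
    intro i j hij d e hd he
    have hmem : ((1 - e * d : R) : A) * (x i * x j) ∈ wordSpan R x 2 := by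
      have e1 : ((1 - e * d : R) : A) * (x i * x j) = (x i * x j - (e : A) * (x j * x i))
          + (e : A) * (x j * x i - (d : A) * (x i * x j)) := by
        push_cast
        noncomm_ring
      rw [e1]
      exact add_mem he (coe_mul_mem_wordSpan _ hd)
    have hz := h.repr_wordSpan_two hmem (i := i) (j := j)
    rw [← stdMonomial_single_add_single x hij, repr_coe_mul_stdMonomial,
      Finsupp.single_eq_same] at hz
    exact (sub_eq_zero.1 hz).symm
  obtain ⟨d, hd⟩ := hex i j
  obtain ⟨e, he⟩ := hex j i
  rcases lt_trichotomy i j with hij | rfl | hij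
  · exact ⟨d, (isUnit_of_mul_eq_one_of_isReduced (hlt i j hij d e hd he)).2, hd⟩
  · exact ⟨1, isUnit_one, by simp⟩
  · exact ⟨d, (isUnit_of_mul_eq_one_of_isReduced (hlt j i hij e d he hd)).1, hd⟩

/-- Words that are permutations of each other agree up to a unit and shorter words. -/
theorem exists_isUnit_of_perm (h : IsSkewPBWExtension R x) [IsReduced R] {v w : List (Fin n)}
    (hvw : v.Perm w) :
    ∃ d : R, IsUnit d ∧ wordVal x v - (d : A) * wordVal x w ∈ wordSpan R x v.length := by
  induction hvw with
  | nil => exact ⟨1, isUnit_one, by simp⟩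
  | @cons i v w _ ih =>
    obtain ⟨d, hd, hmem⟩ := ih
    rename_i hp
    refine ⟨h.sigma i d, h.isUnit_sigma i hd, ?_⟩
    have e : wordVal x (i :: v) - (h.sigma i d : A) * wordVal x (i :: w)
        = x i * (wordVal x v - (d : A) * wordVal x w) + (h.delta i d : A) * wordVal x w := by
      rw [mul_sub, ← mul_assoc (x i) (d : A), h.mul_eq_sigma_delta, wordVal_cons, wordVal_cons]
      noncomm_ring
    rw [e]
    exact add_mem (h.mul_mem_wordSpan i hmem)
      (coe_mul_mem_wordSpan _ (wordVal_mem_wordSpan (by simp [hp.length_eq])))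
  | swap i j w =>
    obtain ⟨d, hd, hmem⟩ := h.exists_isUnit_comm i j
    refine ⟨d, hd, ?_⟩
    have := mul_wordVal_mem_wordSpan hmem w
    rw [sub_mul] at this
    simpa [mul_assoc, add_comm, add_left_comm] using this
  | @trans u v w hp _ ih₁ ih₂ =>
    obtain ⟨d, hd, hmem⟩ := ih₁
    obtain ⟨e, he, hmem'⟩ := ih₂
    refine ⟨d * e, hd.mul he, ?_⟩
    have e1 : wordVal x u - ((d * e : R) : A) * wordVal x w = (wordVal x u - (d : A) * wordVal x v)
        + (d : A) * (wordVal x v - (e : A) * wordVal x w) := by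
      push_cast
      noncomm_ring
    rw [e1]
    rw [← hp.length_eq] at hmem'
    exact add_mem hmem (coe_mul_mem_wordSpan _ hmem')

/-- Sorting a word gives a multiple of a standard monomial of the same length, less than `k`, plus
shorter words covered by induction. -/
theorem repr_eq_zero_of_mem_wordSpan (h : IsSkewPBWExtension R x) [IsReduced R] {k : ℕ} {a : A}
    (ha : a ∈ wordSpan R x k) {α : Fin n → ℕ} (hα : k ≤ ∑ i, α i) : h.basis.repr a α = 0 := by
  induction k using Nat.strong_induction_on generalizing a with
  | _ k ihk =>
  induction ha using Submodule.span_induction with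
  | mem a ha =>
    obtain ⟨w, hw, rfl⟩ := ha
    have hp := perm_stdWord_count w
    obtain ⟨d, -, hd⟩ := h.exists_isUnit_of_perm hp
    have h0 := ihk _ hw hd (hw.le.trans hα)
    rw [wordVal_stdWord, map_sub, repr_coe_mul_stdMonomial, Finsupp.sub_apply,
      Finsupp.single_eq_of_ne, sub_zero] at h0
    · exact h0
    · rintro rfl
      rw [← length_stdWord, ← hp.length_eq] at hα
      omega
  | zero => simp
  | add a b _ _ iha ihb => simp [iha, ihb]
  | smul r a _ ih => simp [ih]

/-- The leading term of a product of two terms. -/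
theorem exists_stdMonomial_mul (h : IsSkewPBWExtension R x) [IsReduced R]
    (hcompat : IsCompatible h.sigma h.delta) (α β : Fin n → ℕ) (r : R) :
    ∃ s : R, (∀ a : R, a * s = 0 → a * r = 0) ∧
      stdMonomial x α * ((r : A) * stdMonomial x β) - (s : A) * stdMonomial x (α + β)
        ∈ wordSpan R x (∑ i, α i + ∑ i, β i) := by
  obtain ⟨s, hs, has⟩ := h.exists_wordVal_mul hcompat (stdWord α) r
  obtain ⟨d, hd, hmem⟩ := h.exists_isUnit_of_perm (stdWord_append_perm α β)
  -- `s` comes from moving `r` past the first monomial, the unit `d` from sorting the concatenated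
  -- word.
  refine ⟨s * d, fun a ha => has a ?_, ?_⟩
  · rw [← mul_assoc] at ha
    exact hd.mul_left_eq_zero.1 ha
  · have h1 := mul_wordVal_mem_wordSpan hs (stdWord β)
    have h2 := coe_mul_mem_wordSpan s hmem
    rw [List.length_append] at h2
    have h3 := add_mem h1 h2
    simp only [wordVal_append, wordVal_stdWord, length_stdWord] at h3
    convert h3 using 1
    push_cast
    noncomm_ring

theorem isReduced (h : IsSkewPBWExtension R x) [IsReduced R]
    (hcompat : IsCompatible h.sigma h.delta) : IsReduced A := by
  refine isReduced_of_mul_self fun f hf => ?_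
  by_contra hf0
  set c := h.basis.repr f with hc
  have hsupp : c.support.Nonempty := by
    rw [Finsupp.support_nonempty_iff]
    simpa [hc] using hf0
  -- The degree-lexicographic leading exponent: only the pair `(γ, γ)` from the support sums to `γ +
  -- γ`.
  obtain ⟨γ, hγ, hmax⟩ := c.support.exists_max_image
    (fun α => toLex (∑ i, α i, toLex α)) hsupp
  have hdeg : ∀ α ∈ c.support, ∑ i, α i ≤ ∑ i, γ i := by
    intro α hα
    rcases Prod.Lex.toLex_le_toLex.1 (hmax α hα) with h1 | h1
    · exact h1.le
    · exact h1.1.le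
  have huniq : ∀ α ∈ c.support, ∀ β ∈ c.support, α + β = γ + γ → α = γ ∧ β = γ := by
    intro α hα β hβ hab
    have hsum : ∑ i, α i + ∑ i, β i = ∑ i, γ i + ∑ i, γ i := by
      rw [← Finset.sum_add_distrib, ← Finset.sum_add_distrib]
      exact congrArg (fun δ : Fin n → ℕ => ∑ i, δ i) hab
    have hα' := hdeg α hα
    have hβ' := hdeg β hβ
    have h1 : toLex α ≤ toLex γ := by
      rcases Prod.Lex.toLex_le_toLex.1 (hmax α hα) with h1 | h1
      · exact absurd h1 (by dsimp only; omega)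
      · exact h1.2
    have h2 : toLex β ≤ toLex γ := by
      rcases Prod.Lex.toLex_le_toLex.1 (hmax β hβ) with h1 | h1
      · exact absurd h1 (by dsimp only; omega)
      · exact h1.2
    have h3 : toLex α + toLex β = toLex γ + toLex γ := congrArg toLex hab
    obtain ⟨h4, h5⟩ := (add_eq_add_iff_eq_and_eq h1 h2).1 h3
    exact ⟨toLex.injective h4, toLex.injective h5⟩
  choose s hs hmem using fun α β => h.exists_stdMonomial_mul hcompat α β (c β)
  have hterm : ∀ α ∈ c.support, ∀ β ∈ c.support,
      h.basis.repr ((c α : A) * stdMonomial x α * ((c β : A) * stdMonomial x β)) (γ + γ)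
        = if α = γ ∧ β = γ then c γ * s γ γ else 0 := by
    intro α hα β hβ
    have e : (c α : A) * stdMonomial x α * ((c β : A) * stdMonomial x β)
        = (c α : A) * (stdMonomial x α * ((c β : A) * stdMonomial x β)
            - (s α β : A) * stdMonomial x (α + β))
          + ((c α * s α β : R) : A) * stdMonomial x (α + β) := by
      push_cast
      noncomm_ring
    -- The error involves only words strictly shorter than `|α| + |β| ≤ 2|γ|`, so it cannot reach `γ
    -- + γ`.
    have hz := h.repr_eq_zero_of_mem_wordSpan (coe_mul_mem_wordSpan (c α) (hmem α β))
      (α := γ + γ) (by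
        have := hdeg α hα
        have := hdeg β hβ
        simp only [Pi.add_apply, Finset.sum_add_distrib]
        omega)
    rw [e, map_add h.basis.repr, Finsupp.add_apply, hz, zero_add, repr_coe_mul_stdMonomial]
    split_ifs with hif
    · rw [hif.1, hif.2, Finsupp.single_eq_same]
    · exact Finsupp.single_eq_of_ne fun hab => hif (huniq α hα β hβ hab.symm)
  have hf' : f = ∑ α ∈ c.support, (c α : A) * stdMonomial x α := by
    conv_lhs => rw [← h.basis.linearCombination_repr f]
    rw [Finsupp.linearCombination_apply, Finsupp.sum]
    refine Finset.sum_congr rfl fun α _ => ?_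
    rw [basis_apply, Subring.smul_def, smul_eq_mul]
  have hcoeff : h.basis.repr (f * f) (γ + γ) = c γ * s γ γ := by
    conv_lhs => rw [hf']
    rw [Finset.sum_mul_sum]
    simp only [map_sum, Finsupp.finsetSum_apply]
    rw [Finset.sum_congr rfl fun α hα => Finset.sum_congr rfl fun β hβ => hterm α hα β hβ]
    rw [Finset.sum_eq_single_of_mem γ hγ, Finset.sum_eq_single_of_mem γ hγ]
    · simp
    · intro β _ hβ; simp [hβ]
    · intro α _ hα; simp [hα]
  rw [hf, map_zero, Finsupp.zero_apply] at hcoeff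
  have hsq := hs γ γ _ hcoeff.symm
  exact Finsupp.mem_support_iff.1 hγ (IsReduced.eq_zero _ ⟨2, by rw [sq, hsq]⟩)

/-! ### Elements of `R` annihilating themselves through `R` -/

/-- The last letter `x i` meets `b` first and yields `σ_i(b)` and `δ_i(b)`, both still annihilated
by `a`; hence induction from the right with `b` varying. -/
theorem coe_mul_wordVal_mul_eq_zero (h : IsSkewPBWExtension R x)
    (hcompat : IsCompatible h.sigma h.delta) (a : R) (w : List (Fin n)) {b : R}
    (hab : a * b = 0) : (a : A) * (wordVal x w * (b : A)) = 0 := by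
  induction w using List.reverseRecOn generalizing b with
  | nil => simpa using congrArg Subtype.val hab
  | append_singleton w i ih =>
    have h1 : a * h.sigma i b = 0 := by
      have := (hcompat.1 a b (Pi.single i 1)).2 hab
      rwa [iterComp_single] at this
    have h2 : a * h.delta i b = 0 := by
      have := hcompat.2 a b (Pi.single i 1) hab
      rwa [iterComp_single] at this
    have e : wordVal x (w ++ [i]) * (b : A)
        = wordVal x w * (h.sigma i b : A) * x i + wordVal x w * (h.delta i b : A) := by
      rw [wordVal_append, wordVal_cons, wordVal_nil, mul_one, mul_assoc, h.mul_eq_sigma_delta,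
        mul_add, mul_assoc]
    rw [e, mul_add, ← mul_assoc, ih h1, ih h2, zero_mul, add_zero]

theorem coe_mul_mul_coe_eq_zero (h : IsSkewPBWExtension R x)
    (hcompat : IsCompatible h.sigma h.delta) {r : R} (hr : ∀ s, r * s * r = 0) (f : A) :
    (r : A) * f * (r : A) = 0 := by
  have hf : f ∈ Submodule.span R (Set.range (stdMonomial x)) := h.span_eq_top ▸ trivial
  -- The extra factor `s` absorbs the left coefficients of `f` in the span induction.
  suffices H : ∀ s : R, ((r * s : R) : A) * f * (r : A) = 0 by simpa using H 1
  induction hf using Submodule.span_induction with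
  | mem f hf =>
    obtain ⟨α, rfl⟩ := hf
    intro s
    rw [← wordVal_stdWord, mul_assoc]
    exact h.coe_mul_wordVal_mul_eq_zero hcompat _ _ (hr s)
  | zero => simp
  | add f g _ _ ihf ihg => intro s; rw [mul_add, add_mul, ihf, ihg, add_zero]
  | smul t f _ ih =>
    intro s
    simpa [Subring.smul_def, mul_assoc] using ih (s * t)

theorem isNilpotent_coe_mul (h : IsSkewPBWExtension R x)
    (hcompat : IsCompatible h.sigma h.delta) {r : R} (hr : ∀ s, r * s * r = 0) (f : A) :
    IsNilpotent ((r : A) * f) :=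
  ⟨2, by rw [sq, ← mul_assoc, h.coe_mul_mul_coe_eq_zero hcompat hr, zero_mul]⟩

/-! ### Powers of a variable -/

theorem pow_injective (h : IsSkewPBWExtension R x) [Nontrivial A] (i : Fin n) :
    Function.Injective fun k : ℕ => x i ^ k := by
  intro k l hkl
  simp only [← stdMonomial_single_eq_pow] at hkl
  exact Pi.single_injective i (h.linearIndependent.injective hkl)

theorem not_isNilpotent (h : IsSkewPBWExtension R x) [Nontrivial A] (i : Fin n) :
    ¬ IsNilpotent (x i) := by
  rintro ⟨k, hk⟩
  have := h.pow_injective i (a₁ := k) (a₂ := k + 1) (by simp only [pow_succ, hk, zero_mul])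
  omega

end IsSkewPBWExtension

end NilpotentGraphPaper

open NilpotentGraphPaper in
theorem mainTheorem2 {A : Type*} [Ring A] (R : Subring A) {n : ℕ} (hn : 1 ≤ n)
    (x : Fin n → A) (hA : IsSkewPBWExtension R x)
    (hcompat : IsCompatible hA.sigma hA.delta) (hprimal : IsTwoPrimal R) :
    ((nilZeroDivisors A).Nonempty → 2 ≤ (nilpotentGraph A).ediam) ∧
    (nilpotentGraph A).ediam ≤ 3 ∧
    (¬ IsReduced R → (nilpotentGraph A).ediam = 2) ∧
    (IsReduced R → (nilpotentGraph A).ediam = (zeroDivisorGraph A).ediam ∧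
      (zeroDivisorGraph A).ediam ≤ 3) := by
  let i : Fin n := ⟨0, hn⟩
  have hnot : ¬ IsReduced R → (nilpotentGraph A).ediam = 2 := by
    intro hR
    obtain ⟨r, hr0, hr⟩ := hprimal.exists_mul_mul_eq_zero hR
    have hr0' : (r : A) ≠ 0 := fun h => hr0 (Subtype.ext h)
    have : Nontrivial A := ⟨⟨r, 0, hr0'⟩⟩
    have hnil := hA.isNilpotent_coe_mul hcompat hr
    have hmem : ∀ a : A, a ≠ 0 → a ∈ nilZeroDivisors A := fun a ha =>
      ⟨ha, r, hr0', isNilpotent_mul_swap (hnil a)⟩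
    have hxi := hA.not_isNilpotent i
    refine le_antisymm (ediam_nilpotentGraph_le_two hr0' hnil) ?_
    refine two_le_ediam (u := ⟨1, hmem 1 one_ne_zero⟩)
      (v := ⟨x i, hmem _ fun h => hxi (h ▸ IsNilpotent.zero)⟩) (fun h => ?_) fun h => hxi ?_
    · have h' : (1 : A) = x i := congrArg Subtype.val h
      exact absurd (hA.pow_injective i (a₁ := 0) (a₂ := 1) (by simpa using h')) (by norm_num)
    · simpa using h.2
  by_cases hR : IsReduced R
  · have := hA.isReduced hcompat
    have hle := ediam_nilpotentGraph_le_three (S := A)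
    refine ⟨fun hne => ?_, hle, hnot, fun _ => ?_⟩
    · have : Nontrivial A := ⟨⟨_, 0, hne.some_mem.1⟩⟩
      refine two_le_ediam_nilpotentGraph_of_isReduced (y := x i) (fun h => ?_) hne
      exact absurd (hA.pow_injective i (a₁ := 2) (a₂ := 1) (by simpa [sq] using h)) (by norm_num)
    · have heq := ediam_nilpotentGraph_eq_ediam_zeroDivisorGraph (S := A)
      exact ⟨heq, heq ▸ hle⟩
  · have h2 := hnot hR
    exact ⟨fun _ => h2.ge, h2.le.trans (by norm_num), hnot, fun h => absurd h hR⟩
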